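/- Let $0<\underline\theta<\bar\theta$ and let $f$ be a probability density on $\Theta=[\underline\theta,\bar\theta]$ with full support (every nondegenerate subinterval has positive probability). For a budget $T>0$ and a function $\Gamma:[0,\infty)\to[0,\infty)$ that is twice continuously differentiable, strictly increasing and strictly convex with $\Gamma(0)=0$, consider the cost function $\Psi(x,\theta)=\theta\,\Gamma(x)$. A mechanism is a pair of functions $x:\Theta\to[0,\infty)$, $t:\Theta\to[0,\infty)$; it is feasible if for all $\theta,\theta'\in\Theta$ $$t(\theta)-\Psi(x(\theta),\theta)\ \ge\ t(\theta')-\Psi(x(\theta'),\theta),\qquad t(\theta)-\Psi(x(\theta),\theta)\ge 0,\qquad t(\theta)\le T,$$ and optimal if it maximizes $\int_{\underline\theta}^{\bar\theta}x(\theta)f(\theta)\,d\theta$ among all feasible mechanisms. Then the largest type that receives the full transfer in the optimal mechanism does not depend on $T$ or $\Gamma$. Precisely: there is a number $\hat\theta$, depending only on $\underline\theta,\bar\theta,f$, such that for every such $T$ and $\Gamma$: 1. there is an optimal mechanism whose schedule $x$ is left-continuous on $(\underline\theta,\bar\theta]$; 2. for every optimal mechanism $(x,t)$, $\hat\theta=\sup\{\theta\in\Theta: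 t(\theta)=T\}$; and if $x$ is left-continuous at $\hat\theta$, then $t(\hat\theta)=T$, so that $\hat\theta$ is the largest type that receives the full transfer. -/

import Mathlib

open Set MeasureTheory

/-- `f` is a probability density on the type space `[a, b]` with full support: every nondegenerate
subinterval of `[a, b]` has positive probability. -/
structure IsTypeDensity (a b : ℝ) (f : ℝ → ℝ) : Prop where
  integrable : IntervalIntegrable f volume a b
  nonneg : ∀ θ ∈ Icc a b, 0 ≤ f θ
  total : ∫ θ in a..b, f θ = 1
  full_support : ∀ c d : ℝ, a ≤ c → c < d → d ≤ b → 0 < ∫ θ in c..d, f θ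

/-- The action-dependent factor `Γ : [0, ∞) → [0, ∞)` of a separable cost `Ψ(x, θ) = θ Γ(x)`:
normalized at zero, twice continuously differentiable, strictly increasing, strictly convex.
Only the values on `[0, ∞)` matter. -/
structure IsCostFactor (Γ : ℝ → ℝ) : Prop where
  map_zero : Γ 0 = 0
  contDiff : ContDiffOn ℝ 2 Γ (Ici 0)
  strictMono : StrictMonoOn Γ (Ici 0)
  strictConvex : StrictConvexOn ℝ (Ici 0) Γ

/-- The separable cost function `Ψ(x, θ) = θ Γ(x)`. -/
def separableCost (Γ : ℝ → ℝ) (x θ : ℝ) : ℝ := θ * Γ x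

/-- The direct mechanism with action schedule `x : [a, b] → [0, ∞)` and transfer schedule
`t : [a, b] → [0, ∞)` is feasible for the cost function `Ψ` and the budget `T`.
Values of `x` and `t` outside `[a, b]` play no role. -/
structure IsFeasible (a b : ℝ) (Ψ : ℝ → ℝ → ℝ) (T : ℝ) (x t : ℝ → ℝ) : Prop where
  action_nonneg : ∀ θ ∈ Icc a b, 0 ≤ x θ
  transfer_nonneg : ∀ θ ∈ Icc a b, 0 ≤ t θ
  incentive_compatible : ∀ θ ∈ Icc a b, ∀ θ' ∈ Icc a b,
    t θ' - Ψ (x θ') θ ≤ t θ - Ψ (x θ) θ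
  individually_rational : ∀ θ ∈ Icc a b, 0 ≤ t θ - Ψ (x θ) θ
  budget : ∀ θ ∈ Icc a b, t θ ≤ T

/-- The objective of the principal: the expected action. -/
noncomputable def expectedAction (a b : ℝ) (f x : ℝ → ℝ) : ℝ :=
  ∫ θ in a..b, x θ * f θ

/-- `(x, t)` maximizes the expected action among all feasible mechanisms. -/
structure IsOptimal (a b : ℝ) (f : ℝ → ℝ) (Ψ : ℝ → ℝ → ℝ) (T : ℝ) (x t : ℝ → ℝ) : Prop where
  feasible : IsFeasible a b Ψ T x t
  optimal : ∀ y s : ℝ → ℝ, IsFeasible a b Ψ T y s →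
    expectedAction a b f y ≤ expectedAction a b f x

/-- The types in `[a, b]` that receive the full transfer `T`. -/
def fullyPaidTypes (a b T : ℝ) (t : ℝ → ℝ) : Set ℝ := {θ ∈ Icc a b | t θ = T}

/-!
Incentive compatibility forces the action `x`, hence the cost level `q = Γ ∘ x`, to be decreasing
in the type, and forces the transfer to the most efficient type `a`, which is the largest
transfer, to be at least `a * q a + ∫ q` (`IsFeasible.outlay_le`); conversely every decreasing `x`
is implemented by transfers that attain this bound (`isFeasible_of_antitoneOn`). So the principal
maximizes `∫ x f` over decreasing schedules subject to `a * q a + ∫ q ≤ T`.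

Extend `x` to `[0, b]` by its value at `a`, and let `c s` be the length of
`{θ ∈ (0, b] | s < x θ}`, the cutoff type at the action level `s`. By Fubini the objective is
`∫ F (c s) ds`, where `F` is the distribution function of the types, and the outlay is
`∫ Γ' s * c s ds`. The Lagrangian `∫ (F (c s) - μ * Γ' s * c s) ds` (`expectedAction_sub_outlay`)
decouples: it is maximal as soon as, for almost every `s`, the cutoff `c s` maximizes
`F u - β * u` over `u ∈ [0, b]` at `β = μ * Γ' s`, that is, `c s` is a point where the supporting
line of slope `β` touches the graph of `F` (`IsPeak`). Touching points move to the left as `β`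
increases, and `Γ'` is strictly increasing, so choosing the last touching point at each level
defines a decreasing schedule (`levelInverse`). The price `μ` is found by the intermediate value
theorem (`exists_top_outlay_eq`).

Let `β₀` be the largest value of `F u / u` and `θhat` the last touching point of slope `β₀`: both
depend on `F` only, and `a < θhat` because `F` vanishes on `[0, a]` (`exists_critical_slope`).
Steeper lines touch only at `0`, and less steep ones only at or beyond `θhat`, the touching points
tending to `θhat` as the slope tends to `β₀`. Every optimal schedule attains the maximum of the
Lagrangian, so its cutoffs are touching points at almost every level. With `x₀` the level where
`μ * Γ' x₀ = β₀`, it is therefore equal to `x₀` below `θhat` and smaller than `x₀` above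
(`eq_top_and_lt_top_of_ae_isPeak`). By incentive compatibility the types that act like type `a`
are exactly those that get the transfer of type `a`, which is `T` because an optimal schedule
exhausts the budget.
-/

open Filter Topology

/-! ### Supporting lines of a profile -/

/-- `s` maximizes `u ↦ F u - β * u` over `[0, b]`: the line of slope `β` supporting the graph of `F`
from above touches it at `s`. -/
def IsPeak (F : ℝ → ℝ) (b β s : ℝ) : Prop :=
  s ∈ Icc 0 b ∧ ∀ u ∈ Icc 0 b, F u - β * u ≤ F s - β * s

/-- The largest point of `[0, b]` at which the supporting line of slope `β` touches the graph
of `F`. -/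
noncomputable def lastPeak (F : ℝ → ℝ) (b β : ℝ) : ℝ := sSup {s | IsPeak F b β s}

section Peaks

variable {F : ℝ → ℝ} {a b β β' s s' : ℝ}

lemma IsPeak.le_lastPeak (h : IsPeak F b β s) : s ≤ lastPeak F b β :=
  le_csSup ⟨b, fun _ hu => hu.1.2⟩ h

lemma isPeak_lastPeak (hF : Continuous F) (hb : 0 ≤ b) (β : ℝ) :
    IsPeak F b β (lastPeak F b β) := by
  have hc : Continuous fun u => F u - β * u := by fun_prop
  have hset : {s | IsPeak F b β s} =
      Icc 0 b ∩ ⋂ u ∈ Icc 0 b, {s | F u - β * u ≤ F s - β * s} := by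
    ext s
    simp [IsPeak]
  have hcomp : IsCompact {s | IsPeak F b β s} := by
    rw [hset]
    exact isCompact_Icc.inter_right
      (isClosed_biInter fun u _ => isClosed_le continuous_const hc)
  obtain ⟨s, hs, hmax⟩ := isCompact_Icc.exists_isMaxOn (nonempty_Icc.2 hb) hc.continuousOn
  exact hcomp.sSup_mem ⟨s, hs, fun u hu => hmax hu⟩

/-- Touching points move to the left as the slope increases. -/
lemma IsPeak.le_of_lt (h : IsPeak F b β s) (h' : IsPeak F b β' s') (hβ : β < β') : s' ≤ s := by
  have h₁ := h.2 s' h'.1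
  have h₂ := h'.2 s h.1
  have : 0 ≤ (β' - β) * (s - s') := by nlinarith
  linarith [nonneg_of_mul_nonneg_right this (sub_pos.2 hβ)]

lemma antitone_lastPeak (hF : Continuous F) (hb : 0 ≤ b) : Antitone (lastPeak F b) := by
  intro β β' h
  rcases h.eq_or_lt with rfl | h
  · exact le_rfl
  · exact (isPeak_lastPeak hF hb β).le_of_lt (isPeak_lastPeak hF hb β') h

/-- The last touching point is a left-continuous function of the slope. -/
lemma exists_lastPeak_lt (hF : Continuous F) (hb : 0 ≤ b) {θ : ℝ} (hθ : lastPeak F b β < θ) :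
    ∃ β' < β, lastPeak F b β' < θ := by
  by_contra! hcon
  have hanti := antitone_lastPeak hF hb
  have ht := hanti.tendsto_leftLim β
  have hlim : IsPeak F b β (Function.leftLim (lastPeak F b) β) := by
    refine ⟨isClosed_Icc.mem_of_tendsto ht
      (Eventually.of_forall fun β' => (isPeak_lastPeak hF hb β').1), fun u hu => ?_⟩
    have hid : Tendsto (fun β' : ℝ => β') (𝓝[<] β) (𝓝 β) := tendsto_id.mono_left nhdsWithin_le_nhds
    refine le_of_tendsto_of_tendsto (tendsto_const_nhds.sub (hid.mul_const u))
      (((hF.tendsto _).comp ht).sub (hid.mul ht))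
      (Eventually.of_forall fun β' => (isPeak_lastPeak hF hb β').2 u hu)
  have hge : θ ≤ Function.leftLim (lastPeak F b) β :=
    ge_of_tendsto ht (eventually_mem_nhdsWithin.mono fun β' h => hcon β' h)
  linarith [hlim.le_lastPeak]

/-- The line of largest slope from the origin that meets the graph of `F`: if `F` vanishes on
`[0, a]` and is positive at `b`, then this line touches the graph to the right of `a`, while every
steeper line stays above the graph except at the origin. -/
lemma exists_critical_slope (hF : Continuous F) (ha : 0 < a) (hab : a < b)
    (hF0 : ∀ u ∈ Icc 0 a, F u = 0) (hFb : 0 < F b) :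
    ∃ β₀, 0 < β₀ ∧ a < lastPeak F b β₀ ∧ ∀ β, β₀ < β → ∀ s, IsPeak F b β s → s = 0 := by
  have hcont : ContinuousOn (fun u => F u / u) (Icc a b) :=
    hF.continuousOn.div continuousOn_id fun u hu => (ha.trans_le hu.1).ne'
  obtain ⟨s, hs, hmax⟩ := isCompact_Icc.exists_isMaxOn (nonempty_Icc.2 hab.le) hcont
  have hs0 : 0 < s := ha.trans_le hs.1
  have hβ : 0 < F s / s :=
    (div_pos hFb (ha.trans hab)).trans_le (hmax (right_mem_Icc.2 hab.le))
  have hle : ∀ u ∈ Icc 0 b, F u ≤ F s / s * u := by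
    intro u hu
    rcases le_total u a with h | h
    · rw [hF0 u ⟨hu.1, h⟩]
      exact mul_nonneg hβ.le hu.1
    · rw [← div_le_iff₀ (ha.trans_le h)]
      exact hmax ⟨h, hu.2⟩
  have hpeak : IsPeak F b (F s / s) s := by
    refine ⟨⟨hs0.le, hs.2⟩, fun u hu => ?_⟩
    rw [div_mul_cancel₀ _ hs0.ne']
    linarith [hle u hu]
  have hpos : 0 < F s := by simpa [div_mul_cancel₀ _ hs0.ne'] using mul_pos hβ hs0
  refine ⟨F s / s, hβ, lt_of_lt_of_le ?_ hpeak.le_lastPeak, fun β hlt u hu => ?_⟩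
  · by_contra! h
    exact hpos.ne' (hF0 s ⟨hs0.le, h⟩)
  · have h0 := hu.2 0 ⟨le_rfl, (ha.trans hab).le⟩
    rw [hF0 0 ⟨le_rfl, ha.le⟩] at h0
    have h1 := hle u hu.1
    have : (β - F s / s) * u ≤ 0 := by linarith
    exact le_antisymm (nonpos_of_mul_nonpos_right this (sub_pos.2 hlt)) hu.1.1

end Peaks

/-! ### Layer-cake representation of a decreasing schedule -/

/-- The length of the set of types in `(0, b]` whose action exceeds `s`. For a decreasing schedule
`y` this set is an interval starting at `0`, so the number is its right end. -/
noncomputable def cutoff (b : ℝ) (y : ℝ → ℝ) (s : ℝ) : ℝ :=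
  volume.real {θ ∈ Ioc 0 b | s < y θ}

section Cutoff

variable {b s s' θ M : ℝ} {y w φ : ℝ → ℝ}

lemma measure_superlevel_ne_top (b : ℝ) (y : ℝ → ℝ) (s : ℝ) :
    volume {θ ∈ Ioc 0 b | s < y θ} ≠ ⊤ :=
  measure_ne_top_of_subset (sep_subset _ _) measure_Ioc_lt_top.ne

lemma cutoff_nonneg : 0 ≤ cutoff b y s := measureReal_nonneg

lemma cutoff_le (hb : 0 ≤ b) : cutoff b y s ≤ b := by
  refine (measureReal_mono (sep_subset _ _) measure_Ioc_lt_top.ne).trans ?_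
  simp [hb]

lemma cutoff_mem_Icc (hb : 0 ≤ b) : cutoff b y s ∈ Icc 0 b := ⟨cutoff_nonneg, cutoff_le hb⟩

lemma antitone_cutoff : Antitone (cutoff b y) := fun _ _ h =>
  measureReal_mono (fun _ hθ => ⟨hθ.1, h.trans_lt hθ.2⟩) (measure_superlevel_ne_top _ _ _)

lemma le_cutoff (hy : Antitone y) (hθ : θ ∈ Ioc 0 b) (hs : s < y θ) : θ ≤ cutoff b y s := by
  have h : volume.real (Ioc 0 θ) ≤ cutoff b y s :=
    measureReal_mono (fun u hu => ⟨⟨hu.1, hu.2.trans hθ.2⟩, hs.trans_le (hy hu.2)⟩)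
      (measure_superlevel_ne_top _ _ _)
  simpa [hθ.1.le] using h

lemma cutoff_le_of_le (hy : Antitone y) (hθ : 0 ≤ θ) (hs : y θ ≤ s) : cutoff b y s ≤ θ := by
  have h : cutoff b y s ≤ volume.real (Ioc 0 θ) := by
    refine measureReal_mono (fun u hu => ⟨hu.1.1, ?_⟩) measure_Ioc_lt_top.ne
    by_contra! h
    exact (hu.2.trans_le (hy h.le)).not_ge hs
  simpa [hθ] using h

lemma lt_of_lt_cutoff (hy : Antitone y) (hθ : 0 ≤ θ) (hs : θ < cutoff b y s) : s < y θ := by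
  by_contra! h
  exact (cutoff_le_of_le hy hθ h).not_gt hs

lemma superlevel_ae_eq_Ioc (hy : Antitone y) (hb : 0 ≤ b) :
    {θ ∈ Ioc 0 b | s < y θ} =ᵐ[volume] Ioc 0 (cutoff b y s) := by
  have hne : ∀ᵐ θ : ℝ, θ ≠ cutoff b y s := by simp [ae_iff]
  filter_upwards [hne] with θ hθ
  refine propext ⟨fun h => ⟨h.1.1, le_cutoff hy h.1 h.2⟩, fun h => ?_⟩
  exact ⟨⟨h.1, h.2.trans (cutoff_le hb)⟩, lt_of_lt_cutoff hy h.1.le (lt_of_le_of_ne h.2 hθ)⟩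

/-- An integral of `Φ ∘ y` against the weight `w`, where `Φ` is the primitive of `φ` vanishing
at `0` and `y` is decreasing, as an integral over action levels. -/
lemma integral_primitive_comp_mul (hy : Antitone y) (hb : 0 ≤ b) (hM : 0 ≤ M)
    (hyM : ∀ θ ∈ Ioc 0 b, y θ ∈ Icc 0 M) (hw : IntervalIntegrable w volume 0 b)
    (hφ : Continuous φ) :
    ∫ θ in 0..b, (∫ s in 0..y θ, φ s) * w θ =
      ∫ s in 0..M, φ s * ∫ θ in 0..cutoff b y s, w θ := by
  have hmeas : MeasurableSet {p : ℝ × ℝ | p.2 < y p.1} :=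
    measurableSet_lt measurable_snd (hy.measurable.comp measurable_fst)
  -- The common integrand on the rectangle `(0, b] × (0, M]`.
  let G : ℝ → ℝ → ℝ := fun θ s =>
    {p : ℝ × ℝ | p.2 < y p.1}.indicator (fun p => w p.1 * φ p.2) (θ, s)
  have hG : IntegrableOn (Function.uncurry G) (uIoc 0 b ×ˢ uIoc 0 M) := by
    have h1 : Integrable (fun p : ℝ × ℝ => w p.1 * φ p.2)
        ((volume.restrict (uIoc 0 b)).prod (volume.restrict (uIoc 0 M))) :=
      (intervalIntegrable_iff.1 hw).mul_prod
        (intervalIntegrable_iff.1 (hφ.intervalIntegrable 0 M))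
    rw [Measure.prod_restrict] at h1
    exact Integrable.indicator h1 hmeas
  have hswap := intervalIntegral_intervalIntegral_swap hG
  have hleft : ∫ θ in 0..b, (∫ s in 0..y θ, φ s) * w θ = ∫ θ in 0..b, ∫ s in 0..M, G θ s := by
    refine intervalIntegral.integral_congr_ae (Eventually.of_forall fun θ hθ => ?_)
    rw [uIoc_of_le hb] at hθ
    obtain ⟨h0, h1⟩ := hyM θ hθ
    have hGθ : ∀ s, G θ s = (Iio (y θ)).indicator (fun s => w θ * φ s) s := fun s => rfl
    simp_rw [hGθ]
    rw [intervalIntegral.integral_of_le hM, intervalIntegral.integral_of_le h0,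
      integral_indicator measurableSet_Iio, Measure.restrict_restrict measurableSet_Iio,
      integral_const_mul, mul_comm]
    congr 1
    refine setIntegral_congr_set ?_
    have hne : ∀ᵐ s : ℝ, s ≠ y θ := by simp [ae_iff]
    filter_upwards [hne] with s hs
    refine propext ⟨fun h => ⟨lt_of_le_of_ne h.2 hs, h.1, h.2.trans h1⟩, fun h => ⟨h.2.1, h.1.le⟩⟩
  have hright : ∫ s in 0..M, ∫ θ in 0..b, G θ s =
      ∫ s in 0..M, φ s * ∫ θ in 0..cutoff b y s, w θ := by
    refine intervalIntegral.integral_congr fun s _ => ?_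
    have hGs : ∀ θ, G θ s = {θ | s < y θ}.indicator (fun θ => φ s * w θ) θ := fun θ => by
      simp only [G, indicator, mem_ofPred_eq, mul_comm]
    have hms : MeasurableSet {θ | s < y θ} := measurableSet_lt measurable_const hy.measurable
    simp_rw [hGs]
    rw [intervalIntegral.integral_of_le hb, intervalIntegral.integral_of_le cutoff_nonneg,
      integral_indicator hms, Measure.restrict_restrict hms, integral_const_mul]
    congr 1
    refine setIntegral_congr_set ?_
    rw [inter_comm]
    exact superlevel_ae_eq_Ioc hy hb
  rw [hleft, hswap, hright]

end Cutoff

/-! ### The marginal cost -/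

/-- The marginal cost `Γ'`, extended to negative actions by its value at `0`. -/
noncomputable def marginal (Γ : ℝ → ℝ) (s : ℝ) : ℝ := derivWithin Γ (Ici 0) (max s 0)

namespace IsCostFactor

variable {Γ : ℝ → ℝ}

lemma continuous_marginal (h : IsCostFactor Γ) : Continuous (marginal Γ) :=
  (h.contDiff.continuousOn_derivWithin (uniqueDiffOn_Ici 0) (by norm_num)).comp_continuous
    (by fun_prop) fun s => le_max_right s 0

lemma strictMonoOn_marginal (h : IsCostFactor Γ) : StrictMonoOn (marginal Γ) (Ici 0) := by
  have := h.strictConvex.strictMonoOn_derivWithin (h.contDiff.differentiableOn (by norm_num))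
  intro s hs s' hs' hlt
  simpa [marginal, max_eq_left hs.out, max_eq_left hs'.out] using this hs hs' hlt

lemma monotone_marginal (h : IsCostFactor Γ) : Monotone (marginal Γ) := fun s s' hle => by
  have := h.strictConvex.strictMonoOn_derivWithin (h.contDiff.differentiableOn (by norm_num))
  exact this.monotoneOn (le_max_right s 0) (le_max_right s' 0) (max_le_max_right 0 hle)

lemma marginal_nonneg (h : IsCostFactor Γ) (s : ℝ) : 0 ≤ marginal Γ s :=
  h.strictMono.monotoneOn.derivWithin_nonneg

lemma marginal_pos (h : IsCostFactor Γ) {s : ℝ} (hs : 0 < s) : 0 < marginal Γ s :=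
  (h.marginal_nonneg 0).trans_lt (h.strictMonoOn_marginal (mem_Ici.2 le_rfl) hs.le hs)

lemma eq_integral_marginal (h : IsCostFactor Γ) {z : ℝ} (hz : 0 ≤ z) :
    Γ z = ∫ s in 0..z, marginal Γ s := by
  rw [intervalIntegral.integral_eq_sub_of_hasDeriv_right_of_le hz
    (h.contDiff.continuousOn.mono Icc_subset_Ici_self) (fun x hx => ?_)
    (h.continuous_marginal.intervalIntegrable _ _), h.map_zero, sub_zero]
  have hd := (h.contDiff.differentiableOn (by norm_num) x hx.1.le).hasDerivWithinAt
  rw [marginal, max_eq_left hx.1.le]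
  exact hd.mono (Ioi_subset_Ici hx.1.le)

lemma nonneg (h : IsCostFactor Γ) {z : ℝ} (hz : 0 ≤ z) : 0 ≤ Γ z := by
  rw [← h.map_zero]
  exact h.strictMono.monotoneOn (mem_Ici.2 le_rfl) hz hz

/-- A cost factor attains every positive value: convexity makes it unbounded. -/
lemma exists_pos_eq (h : IsCostFactor Γ) {c : ℝ} (hc : 0 < c) : ∃ z, 0 < z ∧ Γ z = c := by
  have hm := h.marginal_pos one_pos
  have hgrow : ∀ z, 1 ≤ z → marginal Γ 1 * (z - 1) ≤ Γ z := by
    intro z hz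
    rcases hz.eq_or_lt with rfl | hz
    · simpa using h.nonneg zero_le_one
    · have hslope := h.strictConvex.convexOn.derivWithin_le_slope (x := 1) (y := z)
        (by simp) (mem_Ici.2 (by linarith)) hz
        (h.contDiff.differentiableOn (by norm_num) 1 (by simp))
      rw [slope_def_field, le_div_iff₀ (by linarith)] at hslope
      have h1 := h.nonneg zero_le_one
      simp only [marginal, max_eq_left (zero_le_one' ℝ)]
      linarith
  obtain ⟨z, hz1, hz⟩ : ∃ z, 1 ≤ z ∧ c ≤ Γ z := by
    refine ⟨1 + c / marginal Γ 1, by linarith [div_pos hc hm], ?_⟩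
    refine le_trans (le_of_eq ?_) (hgrow _ (by linarith [div_pos hc hm]))
    field_simp
    ring
  obtain ⟨x, hx, hxc⟩ := intermediate_value_Icc (zero_le_one.trans hz1)
    (h.contDiff.continuousOn.mono Icc_subset_Ici_self)
    (show c ∈ Icc (Γ 0) (Γ z) from ⟨by rw [h.map_zero]; exact hc.le, hz⟩)
  refine ⟨x, lt_of_le_of_ne hx.1 ?_, hxc⟩
  rintro rfl
  exact hc.ne (h.map_zero.symm.trans hxc)

end IsCostFactor

/-! ### Feasible mechanisms -/

/-- What the schedule `x` costs the principal when the least efficient type gets no rent: the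
transfer to the most efficient type `a`, which is the largest one. -/
noncomputable def outlay (a b : ℝ) (Γ x : ℝ → ℝ) : ℝ := a * Γ (x a) + ∫ θ in a..b, Γ (x θ)

/-- The schedule `x` on `[a, b]`, continued to the line by its values at `a` and `b`. -/
def clamped (a b : ℝ) (x : ℝ → ℝ) (θ : ℝ) : ℝ := x (max a (min θ b))

section Clamped

variable {a b θ : ℝ} {x f : ℝ → ℝ}

lemma clamp_mem (hab : a ≤ b) (θ : ℝ) : max a (min θ b) ∈ Icc a b :=
  ⟨le_max_left _ _, max_le hab (min_le_right _ _)⟩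

lemma clamped_of_mem (h : θ ∈ Icc a b) : clamped a b x θ = x θ := by
  simp [clamped, min_eq_left h.2, max_eq_right h.1]

lemma clamped_of_le (hab : a ≤ b) (h : θ ≤ a) : clamped a b x θ = x a := by
  simp [clamped, min_eq_left (h.trans hab), max_eq_left h]

lemma antitone_clamped (hab : a ≤ b) (hx : AntitoneOn x (Icc a b)) : Antitone (clamped a b x) :=
  fun _ _ h => hx (clamp_mem hab _) (clamp_mem hab _) (max_le_max_left _ (min_le_min_right _ h))

lemma clamped_mem_Icc (hab : a ≤ b) (hx : AntitoneOn x (Icc a b)) (h0 : ∀ θ ∈ Icc a b, 0 ≤ x θ)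
    {M : ℝ} (hM : x a ≤ M) (θ : ℝ) : clamped a b x θ ∈ Icc 0 M :=
  ⟨h0 _ (clamp_mem hab θ),
    (hx (left_mem_Icc.2 hab) (clamp_mem hab θ) (le_max_left _ _)).trans hM⟩

lemma integral_clamped_mul_indicator (ha : 0 ≤ a) (hab : a ≤ b) :
    ∫ θ in 0..b, clamped a b x θ * (Ioc a b).indicator f θ = expectedAction a b f x := by
  rw [expectedAction, intervalIntegral.integral_of_le (ha.trans hab),
    intervalIntegral.integral_of_le hab]
  have h : (fun θ => clamped a b x θ * (Ioc a b).indicator f θ) =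
      (Ioc a b).indicator fun θ => x θ * f θ := by
    funext θ
    by_cases hθ : θ ∈ Ioc a b
    · simp [hθ, clamped_of_mem (Ioc_subset_Icc_self hθ)]
    · simp [hθ]
  rw [h, integral_indicator measurableSet_Ioc, Measure.restrict_restrict measurableSet_Ioc,
    inter_eq_left.2 (Ioc_subset_Ioc_left ha)]

lemma integral_comp_clamped (ha : 0 ≤ a) (hab : a ≤ b) {Γ : ℝ → ℝ}
    (hq : AntitoneOn (fun θ => Γ (x θ)) (Icc a b)) :
    ∫ θ in 0..b, Γ (clamped a b x θ) = outlay a b Γ x := by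
  have hint : ∀ c d, IntervalIntegrable (fun θ => Γ (clamped a b x θ)) volume c d := fun c d =>
    (antitone_clamped hab hq).intervalIntegrable
  rw [← intervalIntegral.integral_add_adjacent_intervals (hint 0 a) (hint a b), outlay]
  congr 1
  · rw [intervalIntegral.integral_congr (g := fun _ => Γ (x a)) fun θ hθ => ?_]
    · simp
    · rw [uIcc_of_le ha] at hθ
      simp only [clamped_of_le hab hθ.2]
  · refine intervalIntegral.integral_congr fun θ hθ => ?_
    rw [uIcc_of_le hab] at hθ
    simp only [clamped_of_mem hθ]

end Clamped

/-- A function whose increments are dominated by the length of the step times the drop of a second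
function over that step does not increase: sum over ever finer uniform partitions. -/
lemma le_of_increment_le {V q : ℝ → ℝ} {a b : ℝ} (hab : a ≤ b)
    (h : ∀ θ ∈ Icc a b, ∀ θ' ∈ Icc a b, θ ≤ θ' → V θ' - V θ ≤ (θ' - θ) * (q θ - q θ')) :
    V b ≤ V a := by
  have hn : ∀ n : ℕ, V b - V a ≤ (b - a) * (q a - q b) / (n + 1 : ℝ) := by
    intro n
    have hn0 : (0 : ℝ) < n + 1 := by positivity
    let p : ℕ → ℝ := fun i => a + (b - a) / (n + 1) * i
    have hstep : ∀ i, p (i + 1) - p i = (b - a) / (n + 1) := fun i => by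
      simp only [p]; push_cast; ring
    have hpos : 0 ≤ (b - a) / (n + 1 : ℝ) := div_nonneg (sub_nonneg.2 hab) hn0.le
    have hp0 : p 0 = a := by simp [p]
    have hpn : p (n + 1) = b := by
      simp only [p]; push_cast; field_simp; ring
    have hmono : Monotone p := monotone_nat_of_le_succ fun i => by linarith [hstep i]
    have hmem : ∀ i ≤ n + 1, p i ∈ Icc a b := fun i hi =>
      ⟨hp0 ▸ hmono (Nat.zero_le i), hpn ▸ hmono hi⟩
    calc V b - V a = ∑ i ∈ Finset.range (n + 1), (V (p (i + 1)) - V (p i)) := by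
          rw [Finset.sum_range_sub fun i => V (p i), hp0, hpn]
      _ ≤ ∑ i ∈ Finset.range (n + 1), (b - a) / (n + 1) * (q (p i) - q (p (i + 1))) := by
          refine Finset.sum_le_sum fun i hi => ?_
          have hi := Finset.mem_range.1 hi
          rw [← hstep i]
          exact h _ (hmem i (by omega)) _ (hmem (i + 1) (by omega)) (hmono (Nat.le_succ i))
      _ = (b - a) * (q a - q b) / (n + 1 : ℝ) := by
          rw [← Finset.mul_sum, Finset.sum_range_sub' fun i => q (p i), hp0, hpn]
          ring
  have hlim : Tendsto (fun n : ℕ => (b - a) * (q a - q b) / (n + 1 : ℝ)) atTop (𝓝 0) := by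
    simpa [div_eq_mul_inv] using
      (tendsto_one_div_add_atTop_nhds_zero_nat (𝕜 := ℝ)).const_mul ((b - a) * (q a - q b))
  linarith [ge_of_tendsto' hlim hn]

namespace IsFeasible

variable {a b T θ : ℝ} {Γ x t : ℝ → ℝ}

lemma antitoneOn (hΓ : IsCostFactor Γ) (h : IsFeasible a b (separableCost Γ) T x t) :
    AntitoneOn x (Icc a b) := by
  intro θ hθ θ' hθ' hle
  rcases hle.eq_or_lt with rfl | hlt
  · exact le_rfl
  have h1 := h.incentive_compatible θ hθ θ' hθ'
  have h2 := h.incentive_compatible θ' hθ' θ hθ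
  simp only [separableCost] at h1 h2
  refine (hΓ.strictMono.le_iff_le (h.action_nonneg _ hθ') (h.action_nonneg _ hθ)).1 ?_
  have : 0 ≤ (θ' - θ) * (Γ (x θ) - Γ (x θ')) := by linarith
  linarith [nonneg_of_mul_nonneg_right this (sub_pos.2 hlt)]

lemma antitoneOn_cost (hΓ : IsCostFactor Γ) (h : IsFeasible a b (separableCost Γ) T x t) :
    AntitoneOn (fun θ => Γ (x θ)) (Icc a b) := fun _ hθ _ hθ' hle =>
  hΓ.strictMono.monotoneOn (h.action_nonneg _ hθ') (h.action_nonneg _ hθ)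
    (h.antitoneOn hΓ hθ hθ' hle)

/-- The envelope inequality: incentive compatibility forces the rent of type `a` to be at least
`∫ Γ (x θ) dθ`. -/
lemma outlay_le (hΓ : IsCostFactor Γ) (hab : a ≤ b)
    (h : IsFeasible a b (separableCost Γ) T x t) : outlay a b Γ x ≤ t a := by
  have hq := h.antitoneOn_cost hΓ
  have hint : ∀ c ∈ Icc a b, ∀ d ∈ Icc a b,
      IntervalIntegrable (fun θ => Γ (x θ)) volume c d := fun c hc d hd =>
    (hq.mono (ordConnected_Icc.uIcc_subset hc hd)).intervalIntegrable
  have hV := le_of_increment_le (V := fun θ => t θ - θ * Γ (x θ) + ∫ s in a..θ, Γ (x s))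
    (q := fun θ => Γ (x θ)) hab fun θ hθ θ' hθ' hle => ?_
  · have hir := h.individually_rational b (right_mem_Icc.2 hab)
    simp only [separableCost, intervalIntegral.integral_same] at hir hV
    rw [outlay]
    linarith
  · have hic := h.incentive_compatible θ hθ θ' hθ'
    simp only [separableCost] at hic
    have hsplit := intervalIntegral.integral_add_adjacent_intervals
      (hint a (left_mem_Icc.2 hab) θ hθ) (hint θ hθ θ' hθ')
    have hle' : ∫ s in θ..θ', Γ (x s) ≤ (θ' - θ) * Γ (x θ) := by
      have := intervalIntegral.integral_mono_on hle (hint θ hθ θ' hθ')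
        (intervalIntegrable_const (c := Γ (x θ)))
        fun s hs => hq hθ ⟨hθ.1.trans hs.1, hs.2.trans hθ'.2⟩ hs.1
      simpa using this
    linarith

/-- Types with the action of type `a` receive the transfer of type `a`. -/
lemma transfer_eq (hab : a ≤ b) (h : IsFeasible a b (separableCost Γ) T x t)
    (hθ : θ ∈ Icc a b) (hx : x θ = x a) : t θ = t a := by
  have h1 := h.incentive_compatible θ hθ a (left_mem_Icc.2 hab)
  have h2 := h.incentive_compatible a (left_mem_Icc.2 hab) θ hθ
  simp only [separableCost, hx] at h1 h2
  linarith

/-- Types with a smaller action than type `a` receive a smaller transfer. -/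
lemma transfer_lt (hΓ : IsCostFactor Γ) (ha : 0 < a) (hab : a ≤ b)
    (h : IsFeasible a b (separableCost Γ) T x t) (hθ : θ ∈ Icc a b) (hx : x θ < x a) :
    t θ < t a := by
  have h1 := h.incentive_compatible a (left_mem_Icc.2 hab) θ hθ
  simp only [separableCost] at h1
  have := mul_pos ha (sub_pos.2 (hΓ.strictMono (h.action_nonneg _ hθ)
    (h.action_nonneg _ (left_mem_Icc.2 hab)) hx))
  linarith

end IsFeasible

/-- Every decreasing schedule is implemented by the transfers that leave no rent to type `b`. -/
lemma isFeasible_of_antitoneOn {a b T : ℝ} {Γ x : ℝ → ℝ} (hΓ : IsCostFactor Γ) (ha : 0 ≤ a)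
    (hab : a ≤ b) (hx : AntitoneOn x (Icc a b)) (hx0 : ∀ θ ∈ Icc a b, 0 ≤ x θ)
    (hT : outlay a b Γ x ≤ T) :
    IsFeasible a b (separableCost Γ) T x fun θ => θ * Γ (x θ) + ∫ s in θ..b, Γ (x s) := by
  have hq : AntitoneOn (fun θ => Γ (x θ)) (Icc a b) := fun θ hθ θ' hθ' hle =>
    hΓ.strictMono.monotoneOn (hx0 _ hθ') (hx0 _ hθ) (hx hθ hθ' hle)
  have hint : ∀ c ∈ Icc a b, ∀ d ∈ Icc a b,
      IntervalIntegrable (fun θ => Γ (x θ)) volume c d := fun c hc d hd =>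
    (hq.mono (ordConnected_Icc.uIcc_subset hc hd)).intervalIntegrable
  have hb := right_mem_Icc.2 hab
  have ha' := left_mem_Icc.2 hab
  have hrent : ∀ θ ∈ Icc a b, 0 ≤ ∫ s in θ..b, Γ (x s) := fun θ hθ =>
    intervalIntegral.integral_nonneg hθ.2 fun s hs => hΓ.nonneg (hx0 s ⟨hθ.1.trans hs.1, hs.2⟩)
  have hic : ∀ θ ∈ Icc a b, ∀ θ' ∈ Icc a b,
      θ' * Γ (x θ') + (∫ s in θ'..b, Γ (x s)) - separableCost Γ (x θ') θ ≤
        θ * Γ (x θ) + (∫ s in θ..b, Γ (x s)) - separableCost Γ (x θ) θ := by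
    intro θ hθ θ' hθ'
    have hsplit := intervalIntegral.integral_add_adjacent_intervals
      (hint θ hθ θ' hθ') (hint θ' hθ' b hb)
    have hkey : (θ' - θ) * Γ (x θ') ≤ ∫ s in θ..θ', Γ (x s) := by
      rcases le_total θ θ' with hle | hle
      · have := intervalIntegral.integral_mono_on hle (intervalIntegrable_const (c := Γ (x θ')))
          (hint θ hθ θ' hθ') fun s hs => hq ⟨hθ.1.trans hs.1, hs.2.trans hθ'.2⟩ hθ' hs.2
        simpa using this
      · have := intervalIntegral.integral_mono_on hle (hint θ' hθ' θ hθ)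
          (intervalIntegrable_const (c := Γ (x θ')))
          fun s hs => hq hθ' ⟨hθ'.1.trans hs.1, hs.2.trans hθ.2⟩ hs.1
        rw [intervalIntegral.integral_symm]
        simp only [intervalIntegral.integral_const, smul_eq_mul] at this
        linarith
    simp only [separableCost]
    linarith
  refine ⟨hx0, fun θ hθ => ?_, hic, fun θ hθ => ?_, fun θ hθ => ?_⟩
  · exact add_nonneg (mul_nonneg (ha.trans hθ.1) (hΓ.nonneg (hx0 θ hθ))) (hrent θ hθ)
  · simpa [separableCost] using hrent θ hθ
  · have h1 := hic a ha' θ hθ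
    have h2 := mul_le_mul_of_nonneg_left (hq ha' hθ hθ.1) ha
    simp only [separableCost] at h1
    rw [outlay] at hT
    linarith

/-! ### The Lagrangian -/

/-- The probability of the types in `[a, b]` up to `c`; it vanishes for `c ≤ a`. -/
noncomputable def typeCDF (a b : ℝ) (f : ℝ → ℝ) (c : ℝ) : ℝ :=
  ∫ θ in 0..c, (Ioc a b).indicator f θ

section TypeCDF

variable {a b : ℝ} {f : ℝ → ℝ}

lemma IsTypeDensity.integrable_indicator (hf : IsTypeDensity a b f) (hab : a ≤ b) :
    Integrable ((Ioc a b).indicator f) :=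
  ((intervalIntegrable_iff_integrableOn_Ioc_of_le hab).1 hf.integrable).integrable_indicator
    measurableSet_Ioc

lemma IsTypeDensity.continuous_typeCDF (hf : IsTypeDensity a b f) (hab : a ≤ b) :
    Continuous (typeCDF a b f) :=
  intervalIntegral.continuous_primitive
    (fun _ _ => (hf.integrable_indicator hab).intervalIntegrable) 0

lemma typeCDF_of_mem {u : ℝ} (hu : u ∈ Icc 0 a) : typeCDF a b f u = 0 := by
  rw [typeCDF, intervalIntegral.integral_congr (g := fun _ => 0) fun θ hθ => ?_]
  · simp
  · rw [uIcc_of_le hu.1] at hθ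
    exact indicator_of_notMem (fun h => (h.1.trans_le (hθ.2.trans hu.2)).false) f

lemma IsTypeDensity.typeCDF_right (hf : IsTypeDensity a b f) (ha : 0 ≤ a) (hab : a ≤ b) :
    typeCDF a b f b = 1 := by
  rw [← hf.total, typeCDF, intervalIntegral.integral_of_le (ha.trans hab),
    intervalIntegral.integral_of_le hab, integral_indicator measurableSet_Ioc,
    Measure.restrict_restrict measurableSet_Ioc, inter_eq_left.2 (Ioc_subset_Ioc_left ha)]

end TypeCDF

/-- The contribution of the action level `s` to the Lagrangian with multiplier `μ` when exactly
the types below `c` act at that level. -/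
noncomputable def levelValue (F Γ : ℝ → ℝ) (μ s c : ℝ) : ℝ := F c - μ * marginal Γ s * c

section Lagrangian

variable {a b M μ : ℝ} {f Γ x : ℝ → ℝ}

lemma intervalIntegrable_comp_cutoff {F y : ℝ → ℝ} (hF : Continuous F) (hb : 0 ≤ b) (c d : ℝ) :
    IntervalIntegrable (fun s => F (cutoff b y s)) volume c d := by
  obtain ⟨K, hK⟩ := isCompact_Icc.exists_bound_of_continuousOn (s := Icc 0 b) hF.continuousOn
  refine (intervalIntegrable_const (c := K)).mono_fun
    (hF.measurable.comp antitone_cutoff.measurable).aestronglyMeasurable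
    (Eventually.of_forall fun s => ?_)
  exact (hK _ (cutoff_mem_Icc hb)).trans (le_abs_self K)

lemma intervalIntegrable_marginal_mul_cutoff (hΓ : IsCostFactor Γ) (y : ℝ → ℝ) (c d : ℝ) :
    IntervalIntegrable (fun s => marginal Γ s * cutoff b y s) volume c d :=
  antitone_cutoff.intervalIntegrable.continuousOn_mul hΓ.continuous_marginal.continuousOn

lemma intervalIntegrable_levelValue {F y : ℝ → ℝ} (hF : Continuous F) (hΓ : IsCostFactor Γ)
    (hb : 0 ≤ b) (c d : ℝ) :
    IntervalIntegrable (fun s => levelValue F Γ μ s (cutoff b y s)) volume c d := by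
  simp only [levelValue, mul_assoc]
  exact (intervalIntegrable_comp_cutoff hF hb c d).sub
    ((intervalIntegrable_marginal_mul_cutoff hΓ y c d).const_mul μ)

lemma outlay_eq_integral_cutoff (hΓ : IsCostFactor Γ) (ha : 0 ≤ a) (hab : a ≤ b)
    (hx : AntitoneOn x (Icc a b)) (hx0 : ∀ θ ∈ Icc a b, 0 ≤ x θ) (hM : x a ≤ M) :
    outlay a b Γ x = ∫ s in 0..M, marginal Γ s * cutoff b (clamped a b x) s := by
  have hcl := clamped_mem_Icc hab hx hx0 hM
  have h := integral_primitive_comp_mul (w := fun _ => 1) (antitone_clamped hab hx)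
    (ha.trans hab) ((hx0 a (left_mem_Icc.2 hab)).trans hM) (fun θ _ => hcl θ)
    intervalIntegrable_const hΓ.continuous_marginal
  simp only [mul_one, intervalIntegral.integral_const, sub_zero, smul_eq_mul] at h
  rw [← h, ← integral_comp_clamped ha hab fun θ hθ θ' hθ' hle =>
    hΓ.strictMono.monotoneOn (hx0 _ hθ') (hx0 _ hθ) (hx hθ hθ' hle)]
  simp only [hΓ.eq_integral_marginal (hcl _).1]

lemma expectedAction_eq_integral_cutoff (hf : IsTypeDensity a b f) (ha : 0 ≤ a) (hab : a ≤ b)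
    (hx : AntitoneOn x (Icc a b)) (hx0 : ∀ θ ∈ Icc a b, 0 ≤ x θ) (hM : x a ≤ M) :
    expectedAction a b f x = ∫ s in 0..M, typeCDF a b f (cutoff b (clamped a b x) s) := by
  have h := integral_primitive_comp_mul (φ := fun _ => 1) (antitone_clamped hab hx)
    (ha.trans hab) ((hx0 a (left_mem_Icc.2 hab)).trans hM)
    (fun θ _ => clamped_mem_Icc hab hx hx0 hM θ)
    (hf.integrable_indicator hab).intervalIntegrable continuous_const
  simp only [one_mul, intervalIntegral.integral_const, sub_zero, smul_eq_mul, mul_one] at h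
  rw [← integral_clamped_mul_indicator ha hab, h]
  rfl

/-- The Lagrangian decouples across action levels. -/
lemma expectedAction_sub_outlay (hf : IsTypeDensity a b f) (hΓ : IsCostFactor Γ) (ha : 0 ≤ a)
    (hab : a ≤ b) (hx : AntitoneOn x (Icc a b)) (hx0 : ∀ θ ∈ Icc a b, 0 ≤ x θ) (hM : x a ≤ M)
    (μ : ℝ) :
    expectedAction a b f x - μ * outlay a b Γ x =
      ∫ s in 0..M, levelValue (typeCDF a b f) Γ μ s (cutoff b (clamped a b x) s) := by
  rw [expectedAction_eq_integral_cutoff hf ha hab hx hx0 hM,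
    outlay_eq_integral_cutoff hΓ ha hab hx hx0 hM, ← intervalIntegral.integral_const_mul,
    ← intervalIntegral.integral_sub
      (intervalIntegrable_comp_cutoff (hf.continuous_typeCDF hab) (ha.trans hab) _ _)
      ((intervalIntegrable_marginal_mul_cutoff hΓ _ _ _).const_mul μ)]
  simp only [levelValue, mul_assoc]

end Lagrangian

/-! ### The candidate schedule and its price -/

/-- The generalized inverse of a decreasing function `C` of the action level: the largest level at
which type `θ` is still below `C`. It is `0` if there is no such level. -/
noncomputable def levelInverse (C : ℝ → ℝ) (θ : ℝ) : ℝ := sSup {s | 0 ≤ s ∧ θ ≤ C s}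

section LevelInverse

variable {C : ℝ → ℝ} {a b x₀ s θ : ℝ}

lemma levelInverse_nonneg : 0 ≤ levelInverse C θ := Real.sSup_nonneg fun _ hs => hs.1

lemma levelInverse_le (hx₀ : 0 ≤ x₀) (hC : ∀ s, x₀ < s → C s = 0) (hθ : 0 < θ) :
    levelInverse C θ ≤ x₀ := by
  refine Real.sSup_le (fun s hs => ?_) hx₀
  by_contra! h
  exact (hθ.trans_le hs.2).ne' (hC s h)

lemma le_levelInverse (hC : ∀ s, x₀ < s → C s = 0) (hθ : 0 < θ) (hs : 0 ≤ s) (h : θ ≤ C s) :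
    s ≤ levelInverse C θ := by
  refine le_csSup ⟨x₀, fun s hs => ?_⟩ ⟨hs, h⟩
  by_contra! h
  exact (hθ.trans_le hs.2).ne' (hC s h)

lemma exists_of_lt_levelInverse (hs : 0 ≤ s) (h : s < levelInverse C θ) :
    ∃ s', s < s' ∧ θ ≤ C s' := by
  by_contra! hcon
  refine h.not_ge (Real.sSup_le (fun s' hs' => ?_) hs)
  by_contra! hlt
  exact (hcon s' hlt).not_ge hs'.2

lemma antitoneOn_levelInverse (hC : ∀ s, x₀ < s → C s = 0) :
    AntitoneOn (levelInverse C) (Ioi 0) := fun _ hθ _ _ hle =>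
  Real.sSup_le (fun _ hs => le_levelInverse hC hθ hs.1 (hle.trans hs.2)) levelInverse_nonneg

lemma continuousWithinAt_levelInverse (hanti : Antitone C) (hC : ∀ s, x₀ < s → C s = 0) (ha : 0 < a)
    (hθ : a < θ) : ContinuousWithinAt (levelInverse C) (Icc a θ) θ := by
  have hθ0 := ha.trans hθ
  refine tendsto_order.2 ⟨fun v hv => ?_, fun v hv => ?_⟩
  · filter_upwards [self_mem_nhdsWithin] with θ' hθ'
    exact hv.trans_le (antitoneOn_levelInverse hC (ha.trans_le hθ'.1) hθ0 hθ'.2)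
  · obtain ⟨s, hs, hsv⟩ := exists_between hv
    have hs0 : 0 ≤ s := levelInverse_nonneg.trans hs.le
    have hCs : C s < θ := by
      by_contra! h
      exact hs.not_ge (le_levelInverse hC hθ0 hs0 h)
    filter_upwards [mem_nhdsWithin_of_mem_nhds (Ioi_mem_nhds hCs), self_mem_nhdsWithin]
      with θ' hθ' hθ''
    by_contra! h
    obtain ⟨s', hs', hle⟩ := exists_of_lt_levelInverse hs0 (hsv.trans_le h)
    exact hθ'.out.not_ge (hle.trans (hanti hs'.le))

/-- The cutoffs of the generalized inverse of `C` are the values of `C`, except at the countably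
many levels where `C` jumps. The hypothesis that `C` exceeds `a` up to level `x₀` makes the inverse
constant on `(0, a]`, so that clamping it at `a` changes nothing. -/
lemma cutoff_levelInverse_ae (hanti : Antitone C) (hC : ∀ s, x₀ < s → C s = 0)
    (hCb : ∀ s, C s ∈ Icc 0 b) (ha : 0 < a) (hab : a ≤ b) (hCa : ∀ s ≤ x₀, a < C s) :
    ∀ᵐ s : ℝ, 0 ≤ s → cutoff b (clamped a b (levelInverse C)) s = C s := by
  have hcl : Antitone (clamped a b (levelInverse C)) :=
    antitone_clamped hab ((antitoneOn_levelInverse hC).mono fun θ hθ => ha.trans_le hθ.1)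
  filter_upwards [hanti.countable_not_continuousAt.ae_notMem volume] with s hs hs0
  have hcont : ContinuousAt C s := by simpa using hs
  apply le_antisymm
  · refine le_of_forall_gt_imp_ge_of_dense fun θ hθ => ?_
    rcases lt_or_ge b θ with hb | hb
    · exact (cutoff_le (ha.le.trans hab)).trans hb.le
    refine cutoff_le_of_le hcl ((hCb s).1.trans hθ.le) ?_
    by_contra! h
    obtain ⟨s', hs', hle⟩ := exists_of_lt_levelInverse hs0 h
    rw [min_eq_left hb] at hle
    exact hθ.not_ge ((le_max_right _ _).trans (hle.trans (hanti hs'.le)))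
  · refine le_of_forall_lt_imp_le_of_dense fun θ hθ => ?_
    rcases le_or_gt θ 0 with h0 | h0
    · exact h0.trans cutoff_nonneg
    have hθb : θ ≤ b := hθ.le.trans (hCb s).2
    have hsx : s ≤ x₀ := by
      by_contra! h
      rw [hC s h] at hθ
      exact hθ.not_gt h0
    have hmax : max a θ < C s := max_lt (hCa s hsx) hθ
    obtain ⟨s', hs', hlt⟩ : ∃ s', s < s' ∧ max a θ < C s' := by
      have hev : ∀ᶠ s' in 𝓝[>] s, max a θ < C s' :=
        (hcont.tendsto.mono_left nhdsWithin_le_nhds).eventually (lt_mem_nhds hmax)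
      obtain ⟨s', h1, h2⟩ := (hev.and self_mem_nhdsWithin).exists
      exact ⟨s', h2, h1⟩
    refine le_cutoff hcl ⟨h0, hθb⟩ (hs'.trans_le ?_)
    rw [clamped, min_eq_left hθb]
    exact le_levelInverse hC (h0.trans_le (le_max_right _ _)) (hs0.trans hs'.le) hlt.le

end LevelInverse

section Price

variable {F Γ : ℝ → ℝ} {a b T β₀ : ℝ}

/-- Aggregate outlay varies continuously with the top action `x`, although the last touching point
jumps: it jumps at countably many slopes only, and the slope is an injective function of the
level. -/
lemma continuousAt_outlay_of_top (hF : Continuous F) (hΓ : IsCostFactor Γ) (hb : 0 ≤ b)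
    (hβ₀ : 0 < β₀) {M x : ℝ} (hM : 0 ≤ M) (hx : 0 < x) :
    ContinuousAt
      (fun x => ∫ s in 0..M, marginal Γ s * lastPeak F b (β₀ / marginal Γ x * marginal Γ s)) x := by
  have hanti := antitone_lastPeak hF hb
  have hmeas : Measurable (marginal Γ) := hΓ.continuous_marginal.measurable
  refine intervalIntegral.continuousAt_of_dominated_interval (bound := fun s => marginal Γ s * b)
    (Eventually.of_forall fun x => ?_)
    (Eventually.of_forall fun x => Eventually.of_forall fun s _ => ?_)
    ((hΓ.continuous_marginal.mul continuous_const).intervalIntegrable _ _) ?_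
  · exact (hmeas.mul (hanti.measurable.comp (hmeas.const_mul _))).aestronglyMeasurable
  · have hp := (isPeak_lastPeak hF hb (β₀ / marginal Γ x * marginal Γ s)).1
    rw [Real.norm_of_nonneg (mul_nonneg (hΓ.marginal_nonneg s) hp.1)]
    exact mul_le_mul_of_nonneg_left hp.2 (hΓ.marginal_nonneg s)
  · have hpos : 0 < β₀ / marginal Γ x := div_pos hβ₀ (hΓ.marginal_pos hx)
    have hinj : InjOn (fun s => β₀ / marginal Γ x * marginal Γ s) (Ioi 0) := fun s hs s' hs' h =>
      hΓ.strictMonoOn_marginal.injOn hs.out.le hs'.out.le (mul_left_cancel₀ hpos.ne' h)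
    have hcount : {s | s ∈ Ioi 0 ∧
        ¬ContinuousAt (lastPeak F b) (β₀ / marginal Γ x * marginal Γ s)}.Countable := by
      refine countable_of_injective_of_countable_image (hinj.mono fun s hs => hs.1)
        (hanti.countable_not_continuousAt.mono ?_)
      rintro _ ⟨s, hs, rfl⟩
      exact hs.2
    filter_upwards [hcount.ae_notMem volume] with s hs hsM
    rw [uIoc_of_le hM] at hsM
    have hc : ContinuousAt (lastPeak F b) (β₀ / marginal Γ x * marginal Γ s) := by
      by_contra h
      exact hs ⟨hsM.1, h⟩
    have hslope : ContinuousAt (fun x => β₀ / marginal Γ x * marginal Γ s) x :=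
      (continuousAt_const.div hΓ.continuous_marginal.continuousAt
        (hΓ.marginal_pos hx).ne').mul continuousAt_const
    exact continuousAt_const.mul (ContinuousAt.comp (f := fun x => β₀ / marginal Γ x * marginal Γ s)
      hc hslope)

lemma lastPeak_eq_zero_of_top_lt (hF : Continuous F) (hΓ : IsCostFactor Γ) (hb : 0 ≤ b)
    (hβ₀ : 0 < β₀) (hcrit : ∀ β, β₀ < β → ∀ s, IsPeak F b β s → s = 0) {x s : ℝ} (hx : 0 < x)
    (hs : x < s) : lastPeak F b (β₀ / marginal Γ x * marginal Γ s) = 0 := by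
  refine hcrit _ ?_ _ (isPeak_lastPeak hF hb _)
  rw [div_mul_eq_mul_div, lt_div_iff₀ (hΓ.marginal_pos hx)]
  exact mul_lt_mul_of_pos_left (hΓ.strictMonoOn_marginal hx.le (hx.trans hs).le hs) hβ₀

lemma slope_le_of_le_top (hΓ : IsCostFactor Γ) (hβ₀ : 0 < β₀) {x s : ℝ} (hx : 0 < x)
    (hs : s ≤ x) : β₀ / marginal Γ x * marginal Γ s ≤ β₀ := by
  rw [div_mul_eq_mul_div, div_le_iff₀ (hΓ.marginal_pos hx)]
  exact mul_le_mul_of_nonneg_left (hΓ.monotone_marginal hs) hβ₀.le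

/-- The top action can be chosen so that the outlay exhausts the budget. -/
lemma exists_top_outlay_eq (hF : Continuous F) (hΓ : IsCostFactor Γ) (ha : 0 < a) (hab : a < b)
    (hβ₀ : 0 < β₀) (hcrit : ∀ β, β₀ < β → ∀ s, IsPeak F b β s → s = 0)
    (ha₀ : a < lastPeak F b β₀) (hT : 0 < T) :
    ∃ x M, 0 < x ∧ x ≤ M ∧
      ∫ s in 0..M, marginal Γ s * lastPeak F b (β₀ / marginal Γ x * marginal Γ s) = T := by
  have hb := ha.trans hab
  have hanti := antitone_lastPeak hF hb.le
  -- All cutoffs are at most `b`, and at least `a` below the top action. Hence the outlay is at most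
  -- `T` for the top action `ε` with `b * Γ ε = T` and at least `T` for `M` with `a * Γ M = T`.
  obtain ⟨ε, hε, hεT⟩ := hΓ.exists_pos_eq (div_pos hT hb)
  obtain ⟨M, hM, hMT⟩ := hΓ.exists_pos_eq (div_pos hT ha)
  have hεM : ε ≤ M := by
    refine (hΓ.strictMono.le_iff_le hε.le hM.le).1 ?_
    rw [hεT, hMT]
    gcongr
  have hint : ∀ x c d, IntervalIntegrable
      (fun s => marginal Γ s * lastPeak F b (β₀ / marginal Γ x * marginal Γ s)) volume c d := by
    intro x c d
    refine IntervalIntegrable.continuousOn_mul ?_ hΓ.continuous_marginal.continuousOn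
    obtain h | h := le_total 0 (β₀ / marginal Γ x)
    · exact Antitone.intervalIntegrable fun s s' hle =>
        hanti (mul_le_mul_of_nonneg_left (hΓ.monotone_marginal hle) h)
    · exact Monotone.intervalIntegrable fun s s' hle =>
        hanti (mul_le_mul_of_nonpos_left (hΓ.monotone_marginal hle) h)
  have hcont : ContinuousOn (fun x => ∫ s in 0..M,
      marginal Γ s * lastPeak F b (β₀ / marginal Γ x * marginal Γ s)) (Icc ε M) := fun x hx =>
    (continuousAt_outlay_of_top hF hΓ hb.le hβ₀ hM.le
      (hε.trans_le hx.1)).continuousWithinAt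
  have hlow : ∫ s in 0..M, marginal Γ s * lastPeak F b (β₀ / marginal Γ ε * marginal Γ s) ≤ T := by
    rw [← intervalIntegral.integral_add_adjacent_intervals (hint ε 0 ε) (hint ε ε M)]
    have h0 : ∫ s in ε..M, marginal Γ s * lastPeak F b (β₀ / marginal Γ ε * marginal Γ s) = 0 := by
      refine intervalIntegral.integral_zero_ae (Eventually.of_forall fun s hs => ?_)
      rw [uIoc_of_le hεM] at hs
      rw [lastPeak_eq_zero_of_top_lt hF hΓ hb.le hβ₀ hcrit hε hs.1, mul_zero]
    have h1 := intervalIntegral.integral_mono_on hε.le (hint ε 0 ε)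
      ((hΓ.continuous_marginal.mul continuous_const).intervalIntegrable 0 ε)
      fun s _ => mul_le_mul_of_nonneg_left (isPeak_lastPeak hF hb.le _).1.2 (hΓ.marginal_nonneg s)
    simp only [Pi.mul_apply] at h1
    rw [intervalIntegral.integral_mul_const, ← hΓ.eq_integral_marginal hε.le, hεT,
      div_mul_cancel₀ _ hb.ne'] at h1
    linarith
  have hhigh : T ≤ ∫ s in 0..M,
      marginal Γ s * lastPeak F b (β₀ / marginal Γ M * marginal Γ s) := by
    have h1 := intervalIntegral.integral_mono_on hM.le
      ((hΓ.continuous_marginal.mul continuous_const).intervalIntegrable 0 M) (hint M 0 M)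
      fun s hs => mul_le_mul_of_nonneg_left
        (ha₀.le.trans (hanti (slope_le_of_le_top hΓ hβ₀ hM hs.2))) (hΓ.marginal_nonneg s)
    simp only [Pi.mul_apply] at h1
    rwa [intervalIntegral.integral_mul_const, ← hΓ.eq_integral_marginal hM.le, hMT,
      div_mul_cancel₀ _ ha.ne'] at h1
  obtain ⟨x, hx, hxT⟩ := intermediate_value_Icc hεM hcont ⟨hlow, hhigh⟩
  exact ⟨x, M, hε.trans_le hx.1, hx.2, hxT⟩

end Price

/-! ### Optimality -/

section Optimality

variable {F Γ : ℝ → ℝ} {a b M μ : ℝ} {y z : ℝ → ℝ}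

lemma IsPeak.levelValue_le {s c c' : ℝ} (h : IsPeak F b (μ * marginal Γ s) c)
    (hc' : c' ∈ Icc 0 b) : levelValue F Γ μ s c' ≤ levelValue F Γ μ s c := h.2 c' hc'

lemma integral_levelValue_le (hF : Continuous F) (hΓ : IsCostFactor Γ) (hb : 0 ≤ b) (hM : 0 ≤ M)
    (hz : ∀ᵐ s : ℝ, s ∈ Ioc 0 M → IsPeak F b (μ * marginal Γ s) (cutoff b z s)) :
    ∫ s in 0..M, levelValue F Γ μ s (cutoff b y s) ≤
      ∫ s in 0..M, levelValue F Γ μ s (cutoff b z s) := by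
  refine intervalIntegral.integral_mono_ae_restrict hM (intervalIntegrable_levelValue hF hΓ hb _ _)
    (intervalIntegrable_levelValue hF hΓ hb _ _) ?_
  rw [Measure.restrict_congr_set Ioc_ae_eq_Icc.symm]
  filter_upwards [(ae_restrict_iff' measurableSet_Ioc).2 hz] with s hs
  exact hs.levelValue_le (cutoff_mem_Icc hb)

/-- A schedule attaining the maximum of the Lagrangian maximizes it at almost every level. -/
lemma ae_isPeak_of_integral_le (hF : Continuous F) (hΓ : IsCostFactor Γ) (hb : 0 ≤ b)
    (hM : 0 ≤ M)
    (hz : ∀ᵐ s : ℝ, s ∈ Ioc 0 M → IsPeak F b (μ * marginal Γ s) (cutoff b z s))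
    (hle : ∫ s in 0..M, levelValue F Γ μ s (cutoff b z s) ≤
      ∫ s in 0..M, levelValue F Γ μ s (cutoff b y s)) :
    ∀ᵐ s : ℝ, s ∈ Ioc 0 M → IsPeak F b (μ * marginal Γ s) (cutoff b y s) := by
  have hiz := intervalIntegrable_levelValue (μ := μ) (y := z) hF hΓ hb 0 M
  have hiy := intervalIntegrable_levelValue (μ := μ) (y := y) hF hΓ hb 0 M
  have hnonneg : 0 ≤ᵐ[volume.restrict (Ioc 0 M)] fun s =>
      levelValue F Γ μ s (cutoff b z s) - levelValue F Γ μ s (cutoff b y s) := by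
    filter_upwards [(ae_restrict_iff' measurableSet_Ioc).2 hz] with s hs
    exact sub_nonneg.2 (hs.levelValue_le (cutoff_mem_Icc hb))
  have hzero : ∫ s in 0..M,
      (levelValue F Γ μ s (cutoff b z s) - levelValue F Γ μ s (cutoff b y s)) = 0 := by
    apply le_antisymm
    · rw [intervalIntegral.integral_sub hiz hiy]
      linarith
    · exact intervalIntegral.integral_nonneg_of_ae_restrict hM
        (by rwa [Measure.restrict_congr_set Ioc_ae_eq_Icc.symm])
  rw [intervalIntegral.integral_eq_zero_iff_of_le_of_nonneg_ae hM hnonneg (hiz.sub hiy)] at hzero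
  filter_upwards [(ae_restrict_iff' measurableSet_Ioc).1 hzero, hz] with s hs hzs hsM
  have heq := hs hsM
  have hpk := hzs hsM
  refine ⟨cutoff_mem_Icc hb, fun u hu => (hpk.2 u hu).trans ?_⟩
  simp only [levelValue, Pi.zero_apply] at heq
  linarith

/-- If the cutoffs of a schedule are touching points at almost every level, then the schedule is
constant, equal to the top action `x₀`, strictly below the last touching point of the critical
slope, and smaller than `x₀` above it. -/
lemma eq_top_and_lt_top_of_ae_isPeak {x : ℝ → ℝ} {β₀ x₀ : ℝ} (hF : Continuous F)
    (hΓ : IsCostFactor Γ) (ha : 0 < a) (hab : a < b) (hβ₀ : 0 < β₀)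
    (hcrit : ∀ β, β₀ < β → ∀ s, IsPeak F b β s → s = 0) (hx₀ : 0 < x₀) (hx₀M : x₀ ≤ M)
    (hx : AntitoneOn x (Icc a b)) (hx0 : ∀ θ ∈ Icc a b, 0 ≤ x θ) (hxM : x a ≤ M)
    (hpeak : ∀ᵐ s : ℝ, s ∈ Ioc 0 M →
      IsPeak F b (β₀ / marginal Γ x₀ * marginal Γ s) (cutoff b (clamped a b x) s)) :
    (∀ θ ∈ Icc a b, θ < lastPeak F b β₀ → x θ = x₀) ∧
      ∀ θ ∈ Icc a b, lastPeak F b β₀ < θ → x θ < x₀ := by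
  have hb := (ha.trans hab).le
  have hcl := antitone_clamped hab.le hx
  have hdense := Measure.dense_of_ae hpeak
  have hμ := div_pos hβ₀ (hΓ.marginal_pos hx₀)
  have hμx₀ : β₀ / marginal Γ x₀ * marginal Γ x₀ = β₀ :=
    div_mul_cancel₀ _ (hΓ.marginal_pos hx₀).ne'
  have hup : x a ≤ x₀ := by
    by_contra! h
    obtain ⟨s, hs, hs₁, hs₂⟩ := hdense.exists_between h
    have hslope : β₀ < β₀ / marginal Γ x₀ * marginal Γ s := by
      conv_lhs => rw [← hμx₀]
      exact mul_lt_mul_of_pos_left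
        (hΓ.strictMonoOn_marginal hx₀.le (hx₀.trans hs₁).le hs₁) hμ
    have h0 := hcrit _ hslope _ (hs ⟨hx₀.trans hs₁, hs₂.le.trans hxM⟩)
    have hle := le_cutoff hcl ⟨ha, hab.le⟩
      (by rwa [clamped_of_mem (left_mem_Icc.2 hab.le)] : s < clamped a b x a)
    linarith
  refine ⟨fun θ hθ hlt => ?_, fun θ hθ hlt => ?_⟩
  · refine le_antisymm ((hx (left_mem_Icc.2 hab.le) hθ hθ.1).trans hup) ?_
    by_contra! h
    obtain ⟨s, hs, hs₁, hs₂⟩ := hdense.exists_between h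
    have hs0 : 0 ≤ s := (hx0 θ hθ).trans hs₁.le
    have hs0' : 0 < s := (hx0 θ hθ).trans_lt hs₁
    have hslope : β₀ / marginal Γ x₀ * marginal Γ s < β₀ := by
      conv_rhs => rw [← hμx₀]
      exact mul_lt_mul_of_pos_left (hΓ.strictMonoOn_marginal hs0 hx₀.le hs₂) hμ
    have hge := (hs ⟨hs0', hs₂.le.trans hx₀M⟩).le_of_lt (isPeak_lastPeak hF hb β₀) hslope
    have := lt_of_lt_cutoff hcl (ha.le.trans hθ.1) (hlt.trans_le hge)
    rw [clamped_of_mem hθ] at this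
    exact this.not_gt hs₁
  · obtain ⟨β, hβ, hβθ⟩ := exists_lastPeak_lt hF hb hlt
    have hcont : ContinuousAt (fun s => β₀ / marginal Γ x₀ * marginal Γ s) x₀ :=
      (continuous_const.mul hΓ.continuous_marginal).continuousAt
    have hev := (hcont.eventually (lt_mem_nhds (hμx₀.symm ▸ hβ))).filter_mono
      (nhdsWithin_le_nhds (s := Iio x₀))
    obtain ⟨r, hr, hr0⟩ := (hev.and (Ioo_mem_nhdsLT hx₀)).exists
    obtain ⟨s, hs, hs₁, hs₂⟩ := hdense.exists_between hr0.2
    have hslope : β ≤ β₀ / marginal Γ x₀ * marginal Γ s :=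
      hr.le.trans (mul_le_mul_of_nonneg_left (hΓ.monotone_marginal hs₁.le) hμ.le)
    have hcut := (hs ⟨hr0.1.trans hs₁, hs₂.le.trans hx₀M⟩).le_lastPeak.trans
      (antitone_lastPeak hF hb hslope)
    refine lt_of_le_of_lt ?_ hs₂
    by_contra! h
    have := le_cutoff hcl ⟨ha.trans_le hθ.1, hθ.2⟩
      (by rwa [clamped_of_mem hθ] : s < clamped a b x θ)
    linarith

end Optimality

theorem mainTheorem7 (a b : ℝ) (ha : 0 < a) (hab : a < b)
    (f : ℝ → ℝ) (hf : IsTypeDensity a b f) :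
    ∃ θhat : ℝ, ∀ Γ : ℝ → ℝ, IsCostFactor Γ → ∀ T : ℝ, 0 < T →
      -- an optimal mechanism with left-continuous action schedule exists
      (∃ x t : ℝ → ℝ, IsOptimal a b f (separableCost Γ) T x t ∧
        ∀ θ ∈ Set.Ioc a b, ContinuousWithinAt x (Set.Icc a θ) θ) ∧
      -- for every optimal mechanism, `θhat` is the end of the set of fully paid types,
      -- and it is the largest such type as soon as the schedule is left-continuous there
      ∀ x t : ℝ → ℝ, IsOptimal a b f (separableCost Γ) T x t →
        IsLUB (fullyPaidTypes a b T t) θhat ∧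
        (ContinuousWithinAt x (Set.Icc a θhat) θhat →
          IsGreatest (fullyPaidTypes a b T t) θhat) := by
  have hb := ha.trans hab
  have hF := hf.continuous_typeCDF hab.le
  obtain ⟨β₀, hβ₀, ha₀, hcrit⟩ := exists_critical_slope hF ha hab
    (fun u hu => typeCDF_of_mem hu) (by rw [hf.typeCDF_right ha.le hab.le]; exact one_pos)
  set F := typeCDF a b f
  refine ⟨lastPeak F b β₀, fun Γ hΓ T hT => ?_⟩
  obtain ⟨x₀, M₀, hx₀, hx₀M, hbudget⟩ := exists_top_outlay_eq hF hΓ ha hab hβ₀ hcrit ha₀ hT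
  set μ := β₀ / marginal Γ x₀
  have hμ : 0 < μ := div_pos hβ₀ (hΓ.marginal_pos hx₀)
  have hpeakC : ∀ s, IsPeak F b (μ * marginal Γ s) (lastPeak F b (μ * marginal Γ s)) := fun s =>
    isPeak_lastPeak hF hb.le _
  set C : ℝ → ℝ := fun s => lastPeak F b (μ * marginal Γ s)
  have hCanti : Antitone C := fun s s' hle => antitone_lastPeak hF hb.le
    (mul_le_mul_of_nonneg_left (hΓ.monotone_marginal hle) hμ.le)
  have hC0 : ∀ s, x₀ < s → C s = 0 := fun s hs =>
    lastPeak_eq_zero_of_top_lt hF hΓ hb.le hβ₀ hcrit hx₀ hs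
  have hCa : ∀ s ≤ x₀, a < C s := fun s hs =>
    ha₀.trans_le (antitone_lastPeak hF hb.le (slope_le_of_le_top hΓ hβ₀ hx₀ hs))
  -- The candidate schedule.
  set X := levelInverse C
  have hX : AntitoneOn X (Icc a b) :=
    (antitoneOn_levelInverse hC0).mono fun θ hθ => ha.trans_le hθ.1
  have hX0 : ∀ θ ∈ Icc a b, 0 ≤ X θ := fun θ _ => levelInverse_nonneg
  have hXa : X a ≤ x₀ := levelInverse_le hx₀.le hC0 ha
  have hcut := cutoff_levelInverse_ae hCanti hC0 (fun s => (hpeakC s).1) ha hab.le hCa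
  have hpeakX : ∀ M, ∀ᵐ s : ℝ, s ∈ Ioc 0 M →
      IsPeak F b (μ * marginal Γ s) (cutoff b (clamped a b X) s) := fun M => by
    filter_upwards [hcut] with s hs hsM
    rw [hs hsM.1.le]
    exact hpeakC s
  have houtX : outlay a b Γ X = T := by
    rw [outlay_eq_integral_cutoff hΓ ha.le hab.le hX hX0 (hXa.trans hx₀M), ← hbudget]
    refine intervalIntegral.integral_congr_ae ?_
    filter_upwards [hcut] with s hs hsM
    rw [uIoc_of_le (hx₀.le.trans hx₀M)] at hsM
    rw [hs hsM.1.le]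
  have hfeasX := isFeasible_of_antitoneOn hΓ ha.le hab.le hX hX0 houtX.le
  have hoptX : ∀ y s, IsFeasible a b (separableCost Γ) T y s →
      expectedAction a b f y ≤ expectedAction a b f X := by
    intro y s hy
    have hM : 0 ≤ max (y a) x₀ := hx₀.le.trans (le_max_right _ _)
    have h1 := expectedAction_sub_outlay hf hΓ ha.le hab.le (hy.antitoneOn hΓ) hy.action_nonneg
      (le_max_left (y a) x₀) μ
    have h2 := expectedAction_sub_outlay hf hΓ ha.le hab.le hX hX0
      (hXa.trans (le_max_right (y a) x₀)) μ
    have h3 := integral_levelValue_le (y := clamped a b y) hF hΓ hb.le hM (hpeakX _)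
    have h4 := mul_le_mul_of_nonneg_left ((hy.outlay_le hΓ hab.le).trans
      (hy.budget a (left_mem_Icc.2 hab.le))) hμ.le
    rw [houtX] at h2
    linarith
  refine ⟨⟨X, _, ⟨hfeasX, hoptX⟩, fun θ hθ =>
    continuousWithinAt_levelInverse hCanti hC0 ha hθ.1⟩, fun x t hopt => ?_⟩
  have hfeas := hopt.feasible
  have hxanti := hfeas.antitoneOn hΓ
  have hM : 0 ≤ max (x a) x₀ := hx₀.le.trans (le_max_right _ _)
  have h1 := expectedAction_sub_outlay hf hΓ ha.le hab.le hxanti hfeas.action_nonneg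
    (le_max_left (x a) x₀) μ
  have h2 := expectedAction_sub_outlay hf hΓ ha.le hab.le hX hX0
    (hXa.trans (le_max_right (x a) x₀)) μ
  have hEle := hopt.optimal X _ hfeasX
  have hta := hfeas.budget a (left_mem_Icc.2 hab.le)
  have hout := hfeas.outlay_le hΓ hab.le
  rw [houtX] at h2
  -- An optimal schedule exhausts the budget: slack would put its Lagrangian above the maximum.
  have htaT : t a = T := by
    refine le_antisymm hta (le_trans ?_ hout)
    have h3 := integral_levelValue_le (y := clamped a b x) hF hΓ hb.le hM (hpeakX _)
    by_contra! h
    have := mul_lt_mul_of_pos_left h hμ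
    linarith
  have hpeakx := ae_isPeak_of_integral_le (y := clamped a b x) hF hΓ hb.le hM (hpeakX _) (by
    have := mul_le_mul_of_nonneg_left (hout.trans hta) hμ.le
    linarith)
  obtain ⟨heq, hlt⟩ := eq_top_and_lt_top_of_ae_isPeak hF hΓ ha hab hβ₀ hcrit hx₀
    (le_max_right _ _) hxanti hfeas.action_nonneg (le_max_left _ _) hpeakx
  have hxa : x a = x₀ := heq a (left_mem_Icc.2 hab.le) ha₀
  have hhat : lastPeak F b β₀ ≤ b := (isPeak_lastPeak hF hb.le β₀).1.2
  have hupper : lastPeak F b β₀ ∈ upperBounds (fullyPaidTypes a b T t) := by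
    rintro θ ⟨hθ, htθ⟩
    by_contra! h
    exact (hfeas.transfer_lt hΓ ha hab.le hθ (hxa.symm ▸ hlt θ hθ h)).ne (htθ.trans htaT.symm)
  have hpaid : ∀ θ ∈ Icc a b, x θ = x₀ → θ ∈ fullyPaidTypes a b T t := fun θ hθ hxθ =>
    ⟨hθ, (hfeas.transfer_eq hab.le hθ (hxθ.trans hxa.symm)).trans htaT⟩
  refine ⟨⟨hupper, fun u hu => ?_⟩, fun hcont => ⟨?_, hupper⟩⟩
  · refine le_of_forall_lt_imp_le_of_dense fun θ hθ => (le_max_right a θ).trans (hu ?_)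
    have hmax : max a θ < lastPeak F b β₀ := max_lt ha₀ hθ
    have hmem : max a θ ∈ Icc a b := ⟨le_max_left _ _, hmax.le.trans hhat⟩
    exact hpaid _ hmem (heq _ hmem hmax)
  · refine hpaid _ ⟨ha₀.le, hhat⟩ ?_
    have h3 : Tendsto x (𝓝[Ico a (lastPeak F b β₀)] (lastPeak F b β₀)) (𝓝 x₀) := by
      refine tendsto_const_nhds.congr' ?_
      filter_upwards [self_mem_nhdsWithin] with θ hθ
      exact (heq θ ⟨hθ.1, hθ.2.le.trans hhat⟩ hθ.2).symm
    have h4 := hcont.tendsto.mono_left (nhdsWithin_mono _ Ico_subset_Icc_self)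
    have : (𝓝[Ico a (lastPeak F b β₀)] (lastPeak F b β₀)).NeBot := by
      rw [nhdsWithin_Ico_eq_nhdsLT ha₀]
      infer_instance
    exact tendsto_nhds_unique h4 h3
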